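/- All vector spaces are over $\mathbb{C}$. Let $(\mathcal{L},[\cdot_\lambda\cdot])$ be a Lie conformal algebra: a $\mathbb{C}[\partial]$-module with a bilinear bracket $[p_\lambda q]\in\mathcal{L}[\lambda]$ such that $[\partial p_\lambda q]=-\lambda[p_\lambda q]$, $[p_\lambda \partial q]=(\partial+\lambda)[p_\lambda q]$, $[p_\lambda q]=-[q_{-\partial-\lambda}p]$ and $[p_\lambda[q_\mu r]]=[[p_\lambda q]_{\lambda+\mu}r]+[q_\mu[p_\lambda r]]$. Let $\mathcal{N}$ be a Nijenhuis operator on it, that is, a $\mathbb{C}[\partial]$-linear map $\mathcal{N}:\mathcal{L}\to\mathcal{L}$ with $$[\mathcal{N}(p)_\lambda \mathcal{N}(q)]=\mathcal{N}\big([p_\lambda q]_{\mathcal{N}}\big),\qquad [p_\lambda q]_{\mathcal{N}}:=[\mathcal{N}(p)_\lambda q]+[p_\lambda \mathcal{N}(q)]-\mathcal{N}([p_\lambda q]).$$ *Cohomology.* Let $C^1(\mathcal{L},\mathcal{L})$ be the space of $\mathbb{C}[\partial]$-linear maps $\mathcal{L}\to\mathcal{L}$, and $C^2(\mathcal{L},\mathcal{L})$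 the space of bilinear maps $f_\lambda:\mathcal{L}\times\mathcal{L}\to\mathcal{L}[\lambda]$ with $f_\lambda(\partial p,q)=-\lambda f_\lambda(p,q)$, $f_\lambda(p,\partial q)=(\partial+\lambda)f_\lambda(p,q)$ and $f_\lambda(p,q)=-f_{-\partial-\lambda}(q,p)$. For $J,K\in C^1(\mathcal{L},\mathcal{L})$ let $[J,K]_{FN}\in C^2(\mathcal{L},\mathcal{L})$ be the Frölicher–Nijenhuis bracket $$[J,K]_{FN}(p,q)=[J(p)_\lambda K(q)]+[K(p)_\lambda J(q)]+(JK+KJ)([p_\lambda q])-K\big([J(p)_\lambda q]+[p_\lambda J(q)]\big)-J\big([K(p)_\lambda q]+[p_\lambda K(q)]\big).$$ The differential is $d_{\mathcal{N}}f=[\mathcal{N},f]_{FN}$ on $C^1(\mathcal{L},\mathcal{L})$, and on $C^2(\mathcal{L},\mathcal{L})$ it is, with $\lambda_3=-\partial-\lambda_1-\lambda_2$, $$(d_{\mathcal{N}}f)_{\lambda_1,\lambda_2}(p_1,p_2,p_3)=\sum_{i=1}^{3}(-1)^{i+1}[\mathcal{N}(p_i)_{\lambda_i}f_{\lambda_a}(p_a,p_b)]+\sum_{i<j}(-1)^{i+j}f_{\lambda_i+\lambda_j}\big([{p_i}_{\lambda_i}p_j]_{\mathcal{N}},p_k\big)-\mathcal{N}\Big(\sum_{i=1}^{3}(-1)^{i+1}[{p_i}_{\lambda_i}f_{\lambda_a}(p_a,p_b)]+\sum_{i<j}(-1)^{i+j}f_{\lambda_i+\lambda_j}\big([{p_i}_{\lambda_i}p_j],p_k\big)\Big),$$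 where $\{i,a,b\}=\{1,2,3\}$ with $a<b$ in the first and third sums, and $\{i,j,k\}=\{1,2,3\}$ in the others. Let $H^2_{\mathcal{N}}(\mathcal{L},\mathcal{L})$ be the space of 2-cocycles (the kernel of $d_{\mathcal{N}}$ on $C^2(\mathcal{L},\mathcal{L})$) modulo 2-coboundaries (the image of $d_{\mathcal{N}}$ on $C^1(\mathcal{L},\mathcal{L})$). *Deformations.* Let $n\ge 0$. A deformation of order $n$ of $\mathcal{N}$ is a sum $\mathcal{N}_t=\sum_{i=0}^{n}\mathcal{N}_it^i$ with $\mathcal{N}_i\in C^1(\mathcal{L},\mathcal{L})$ and $\mathcal{N}_0=\mathcal{N}$ that is a Nijenhuis operator on the Lie conformal algebra $\mathcal{L}[[t]]/t^{n+1}$, to which $\partial$ and the bracket are extended $\mathbb{C}[[t]]/t^{n+1}$-linearly. It is extensible if there is $\mathcal{N}_{n+1}\in C^1(\mathcal{L},\mathcal{L})$ such that $\mathcal{N}_t+\mathcal{N}_{n+1}t^{n+1}$ is a deformation of order $n+1$. Its obstruction is $$Ob_{\mathcal{N}_t}=-\frac12\sum_{i+j=n+1,\ i,j\ge1}[\mathcal{N}_i,\mathcal{N}_j]_{FN}\in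 C^2(\mathcal{L},\mathcal{L}).$$ **Theorem.** Let $\mathcal{N}_t$ be a deformation of order $n$ of $\mathcal{N}$. Then $Ob_{\mathcal{N}_t}$ is a 2-cocycle, i.e. $d_{\mathcal{N}}(Ob_{\mathcal{N}_t})=0$, and $\mathcal{N}_t$ is extensible if and only if the class $[Ob_{\mathcal{N}_t}]\in H^2_{\mathcal{N}}(\mathcal{L},\mathcal{L})$ is zero. Consequently, if $H^2_{\mathcal{N}}(\mathcal{L},\mathcal{L})=0$, then every deformation of $\mathcal{N}$ of finite order is extensible. -/

import Mathlib

noncomputable section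

namespace LieConformal

/-- `M[l]`: polynomials `∑ k, l ^ k a_k` in one variable with coefficients in the complex vector
space `M`. -/
abbrev PolyIn (M : Type*) [AddCommGroup M] [Module ℂ M] : Type _ := PolynomialModule ℂ M

section Poly

variable {M M' : Type*} [AddCommGroup M] [Module ℂ M] [AddCommGroup M'] [Module ℂ M']

/-- The value of a polynomial at the scalar `l`. As `ℂ` is infinite, an identity between
polynomials holds if and only if it holds for all scalar values of the variables. -/
def ev (l : ℂ) : PolyIn M →ₗ[ℂ] M := PolynomialModule.eval l

/-- Substitution of an endomorphism `T` for the variable: `∑ k, l ^ k a_k` goes to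
`∑ k, T ^ k (a_k)`, powers of `T` standing on the left of the coefficients. -/
def subst (T : Module.End ℂ M) : PolyIn M →ₗ[ℂ] M :=
  (Finsupp.lsum ℂ fun k => T ^ k) ∘ₗ (PolynomialModule.coeffLinearEquiv ℂ ℂ).toLinearMap

/-- The substitution of `-∂ - l` for the variable. -/
def evNeg (D : Module.End ℂ M) (l : ℂ) : PolyIn M →ₗ[ℂ] M :=
  subst (-D - l • (1 : Module.End ℂ M))

/-- Apply a linear map to each coefficient of a polynomial. -/
def mapCoeff (φ : M →ₗ[ℂ] M') : PolyIn M →ₗ[ℂ] PolyIn M' :=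
  PolynomialModule.map ℂ φ

theorem subst_single (T : Module.End ℂ M) (k : ℕ) (x : M) :
    subst T (PolynomialModule.single ℂ k x) = (T ^ k) x := by
  simp [subst]

theorem mapCoeff_single (φ : M →ₗ[ℂ] M') (k : ℕ) (x : M) :
    mapCoeff φ (PolynomialModule.single ℂ k x) = PolynomialModule.single ℂ k (φ x) := by
  simp [mapCoeff]

theorem map_subst (φ : M →ₗ[ℂ] M') (T : Module.End ℂ M) (S : Module.End ℂ M')
    (h : ∀ x, φ (T x) = S (φ x)) (a : PolyIn M) :
    φ (subst T a) = subst S (mapCoeff φ a) := by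
  have hk : ∀ (k : ℕ) (x : M), φ ((T ^ k) x) = (S ^ k) (φ x) := by
    intro k
    induction k with
    | zero => intro x; simp
    | succ k ih => intro x; rw [pow_succ', pow_succ', Module.End.mul_apply, Module.End.mul_apply,
        h, ih]
  induction a using PolynomialModule.induction_linear with
  | zero => simp
  | add a b ha hb => simp only [map_add, ha, hb]
  | single k x => rw [subst_single, mapCoeff_single, subst_single, hk]

theorem ev_mapCoeff (φ : M →ₗ[ℂ] M') (l : ℂ) (a : PolyIn M) :
    ev l (mapCoeff φ a) = φ (ev l a) :=
  PolynomialModule.eval_map ℂ φ a l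

theorem evNeg_mapCoeff (φ : M →ₗ[ℂ] M') (D : Module.End ℂ M) (D' : Module.End ℂ M')
    (h : ∀ x, φ (D x) = D' (φ x)) (l : ℂ) (a : PolyIn M) :
    evNeg D' l (mapCoeff φ a) = φ (evNeg D l a) :=
  (map_subst φ _ _ (by simp [h]) a).symm

theorem mapCoeff_add (φ ψ : M →ₗ[ℂ] M') (a : PolyIn M) :
    mapCoeff (φ + ψ) a = mapCoeff φ a + mapCoeff ψ a := by
  induction a using PolynomialModule.induction_linear with
  | zero => simp
  | add a b ha hb => simp only [map_add, ha, hb]; abel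
  | single k x => simp [mapCoeff_single]

theorem mapCoeff_smul (c : ℂ) (φ : M →ₗ[ℂ] M') (a : PolyIn M) :
    mapCoeff (c • φ) a = c • mapCoeff φ a := by
  induction a using PolynomialModule.induction_linear with
  | zero => simp
  | add a b ha hb => simp only [map_add, smul_add, ha, hb]
  | single k x => simp [mapCoeff_single, PolynomialModule.single_smul]

theorem mapCoeff_comp {M'' : Type*} [AddCommGroup M''] [Module ℂ M''] (ψ : M' →ₗ[ℂ] M'')
    (φ : M →ₗ[ℂ] M') (a : PolyIn M) :
    mapCoeff ψ (mapCoeff φ a) = mapCoeff (ψ ∘ₗ φ) a := by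
  induction a using PolynomialModule.induction_linear with
  | zero => simp
  | add a b ha hb => simp only [map_add, ha, hb]
  | single k x => simp [mapCoeff_single]

theorem mapCoeff_id (a : PolyIn M) : mapCoeff LinearMap.id a = a := by
  induction a using PolynomialModule.induction_linear with
  | zero => simp
  | add a b ha hb => simp only [map_add, ha, hb]
  | single k x => simp [mapCoeff_single]

theorem mapCoeff_zero (a : PolyIn M) : mapCoeff (0 : M →ₗ[ℂ] M') a = 0 := by
  simpa using mapCoeff_smul 0 (0 : M →ₗ[ℂ] M') a

/-- A conformal 2-cochain on the `ℂ[∂]`-module `(M, ∂ = D)` with values in `M`: a bilinear map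
`f_l : M × M → M[l]` that is conformally sesquilinear and conformally skew-symmetric. -/
structure IsTwoCochain (D : Module.End ℂ M) (f : M →ₗ[ℂ] M →ₗ[ℂ] PolyIn M) : Prop where
  /-- `f_l(∂p, q) = -l f_l(p, q)` -/
  left : ∀ (l : ℂ) (p q : M), ev l (f (D p) q) = -(l • ev l (f p q))
  /-- `f_l(p, ∂q) = (∂ + l) f_l(p, q)` -/
  right : ∀ (l : ℂ) (p q : M), ev l (f p (D q)) = D (ev l (f p q)) + l • ev l (f p q)
  /-- `f_l(p, q) = -f_{-∂-l}(q, p)` -/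
  skew : ∀ (l : ℂ) (p q : M), ev l (f p q) = -evNeg D l (f q p)

end Poly

/-- A Lie conformal algebra: a `ℂ[∂]`-module `L` (a complex vector space with the operator
`D = ∂`) with a `l`-bracket `[p_l q] ∈ L[l]` that is conformally sesquilinear, conformally
skew-symmetric and satisfies the Jacobi identity. -/
structure LieConformalAlgebra (L : Type*) [AddCommGroup L] [Module ℂ L] where
  D : Module.End ℂ L
  br : L →ₗ[ℂ] L →ₗ[ℂ] PolyIn L
  isTwoCochain : IsTwoCochain D br
  /-- `[p_l [q_m r]] = [[p_l q]_{l+m} r] + [q_m [p_l r]]` -/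
  jacobi : ∀ (l m : ℂ) (p q r : L),
    ev l (br p (ev m (br q r))) =
      ev (l + m) (br (ev l (br p q)) r) + ev m (br q (ev l (br p r)))

namespace LieConformalAlgebra

variable {L : Type*} [AddCommGroup L] [Module ℂ L] (A : LieConformalAlgebra L)

/-- The space `C¹(L, L)` of 1-cochains: the `ℂ[∂]`-linear maps `L → L`. -/
def C1 : Submodule ℂ (L →ₗ[ℂ] L) where
  carrier := {f | ∀ p, f (A.D p) = A.D (f p)}
  zero_mem' := by simp
  add_mem' := by
    intro f g hf hg p
    simp [hf p, hg p]
  smul_mem' := by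
    intro c f hf p
    simp [hf p]

/-- The conformal 2-cochains as a subspace of the bilinear maps `L × L → L[l]`. -/
def twoCochains : Submodule ℂ (L →ₗ[ℂ] L →ₗ[ℂ] PolyIn L) where
  carrier := {f | IsTwoCochain A.D f}
  zero_mem' := ⟨by simp, by simp, by simp⟩
  add_mem' := by
    intro f g hf hg
    refine ⟨fun l p q => ?_, fun l p q => ?_, fun l p q => ?_⟩
    · simp only [LinearMap.add_apply, map_add, hf.left, hg.left, smul_add]; abel
    · simp only [LinearMap.add_apply, map_add, hf.right, hg.right, smul_add]; abel
    · simp only [LinearMap.add_apply, map_add, hf.skew l p q, hg.skew l p q]; abel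
  smul_mem' := by
    intro c f hf
    refine ⟨fun l p q => ?_, fun l p q => ?_, fun l p q => ?_⟩
    · simp only [LinearMap.smul_apply, map_smul, hf.left, smul_neg, smul_comm c l]
    · simp only [LinearMap.smul_apply, map_smul, hf.right, smul_add, smul_comm c l]
    · simp only [LinearMap.smul_apply, map_smul, hf.skew l p q, smul_neg]

/-- The vector space `C²(L, L)` of conformal 2-cochains. -/
def C2 : Type _ := A.twoCochains

instance : AddCommGroup A.C2 := inferInstanceAs (AddCommGroup A.twoCochains)

instance : Module ℂ A.C2 := inferInstanceAs (Module ℂ A.twoCochains)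

/-- The bilinear map underlying a 2-cochain. -/
def C2.val {A : LieConformalAlgebra L} (f : A.C2) : L →ₗ[ℂ] L →ₗ[ℂ] PolyIn L := Subtype.val f

theorem C2.ext {A : LieConformalAlgebra L} {f g : A.C2} (h : f.val = g.val) : f = g :=
  Subtype.ext h

theorem C2.val_add {A : LieConformalAlgebra L} (f g : A.C2) : (f + g).val = f.val + g.val := rfl

theorem C2.val_smul {A : LieConformalAlgebra L} (c : ℂ) (f : A.C2) : (c • f).val = c • f.val := rfl

/-- `N` is a Nijenhuis operator:
`[N(p)_l N(q)] = N([N(p)_l q] + [p_l N(q)] - N([p_l q]))`. -/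
def IsNijenhuis (N : A.C1) : Prop :=
  ∀ (l : ℂ) (p q : L),
    ev l (A.br (N.1 p) (N.1 q)) =
      N.1 (ev l (A.br (N.1 p) q) + ev l (A.br p (N.1 q)) - N.1 (ev l (A.br p q)))

/-! ### The Frölicher-Nijenhuis bracket in degree one and the second cohomology -/

/-- The bilinear map `(p, q) ↦ [J(p)_l K(q)]`. -/
def br₂ (J K : L →ₗ[ℂ] L) : L →ₗ[ℂ] L →ₗ[ℂ] PolyIn L := A.br.compl₁₂ J K

/-- The Frölicher-Nijenhuis bracket of two 1-cochains as a bilinear map: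
`[J, K]_l(p, q) = [J(p)_l K(q)] + [K(p)_l J(q)] + (JK + KJ)([p_l q])
  - K([J(p)_l q] + [p_l J(q)]) - J([K(p)_l q] + [p_l K(q)])`. -/
def fnBilin (J K : L →ₗ[ℂ] L) : L →ₗ[ℂ] L →ₗ[ℂ] PolyIn L :=
  A.br₂ J K + A.br₂ K J + A.br.compr₂ (mapCoeff (J ∘ₗ K + K ∘ₗ J))
    - (A.br₂ J LinearMap.id + A.br₂ LinearMap.id J).compr₂ (mapCoeff K)
    - (A.br₂ K LinearMap.id + A.br₂ LinearMap.id K).compr₂ (mapCoeff J)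

theorem br₂_mem (J K : A.C1) : A.br₂ J.1 K.1 + A.br₂ K.1 J.1 ∈ A.twoCochains := by
  have hJ := J.2
  have hK := K.2
  refine ⟨fun l p q => ?_, fun l p q => ?_, fun l p q => ?_⟩
  · simp only [br₂, LinearMap.add_apply, LinearMap.compl₁₂_apply, map_add, hJ p, hK p,
      A.isTwoCochain.left, smul_add]
    abel
  · simp only [br₂, LinearMap.add_apply, LinearMap.compl₁₂_apply, map_add, hJ q, hK q,
      A.isTwoCochain.right, smul_add]
    abel
  · simp only [br₂, LinearMap.add_apply, LinearMap.compl₁₂_apply, map_add]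
    rw [A.isTwoCochain.skew l (J.1 p), A.isTwoCochain.skew l (K.1 p)]
    abel

theorem compr₂_mem {f : L →ₗ[ℂ] L →ₗ[ℂ] PolyIn L} (hf : f ∈ A.twoCochains) (J : A.C1) :
    f.compr₂ (mapCoeff J.1) ∈ A.twoCochains := by
  have hJ := J.2
  have hf' : IsTwoCochain A.D f := hf
  refine ⟨fun l p q => ?_, fun l p q => ?_, fun l p q => ?_⟩
  · simp only [LinearMap.compr₂_apply, ev_mapCoeff, hf'.left, map_neg, map_smul]
  · simp only [LinearMap.compr₂_apply, ev_mapCoeff, hf'.right, map_add, map_smul, hJ _]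
  · simp only [LinearMap.compr₂_apply, ev_mapCoeff,
      evNeg_mapCoeff J.1 A.D A.D (fun x => hJ x), hf'.skew l p q, map_neg]

theorem fnBilin_mem (J K : A.C1) : A.fnBilin J.1 K.1 ∈ A.twoCochains := by
  have hid : (LinearMap.id : L →ₗ[ℂ] L) ∈ A.C1 := fun p => rfl
  have hc : J.1 ∘ₗ K.1 + K.1 ∘ₗ J.1 ∈ A.C1 := by
    have hJ := J.2
    have hK := K.2
    intro p
    simp [hJ _, hK _]
  have h1 := A.br₂_mem J K
  have h2 : A.br.compr₂ (mapCoeff (J.1 ∘ₗ K.1 + K.1 ∘ₗ J.1)) ∈ A.twoCochains :=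
    A.compr₂_mem A.isTwoCochain ⟨_, hc⟩
  have h3 := A.compr₂_mem (A.br₂_mem J ⟨_, hid⟩) K
  have h4 := A.compr₂_mem (A.br₂_mem K ⟨_, hid⟩) J
  exact A.twoCochains.sub_mem (A.twoCochains.sub_mem (A.twoCochains.add_mem h1 h2) h3) h4

/-- The Frölicher-Nijenhuis bracket `C¹(L, L) × C¹(L, L) → C²(L, L)`. -/
def fn (J K : A.C1) : A.C2 :=
  (⟨A.fnBilin J.1 K.1, A.fnBilin_mem J K⟩ : A.twoCochains)

theorem fn_val (J K : A.C1) : (A.fn J K).val = A.fnBilin J.1 K.1 := rfl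

/-- The differential `d_N = [N, -] : C¹(L, L) → C²(L, L)`. -/
def d1 (N : A.C1) : A.C1 →ₗ[ℂ] A.C2 where
  toFun f := A.fn N f
  map_add' f g := by
    apply C2.ext
    ext1 p
    ext1 q
    simp only [C2.val_add, fn_val, fnBilin, br₂, Submodule.coe_add, LinearMap.add_apply, LinearMap.sub_apply,
      LinearMap.compr₂_apply, LinearMap.compl₁₂_apply, LinearMap.id_apply, LinearMap.comp_add,
      LinearMap.add_comp, map_add, mapCoeff_add]
    abel
  map_smul' c f := by
    apply C2.ext
    ext1 p
    ext1 q
    simp only [C2.val_smul, fn_val, fnBilin, br₂, Submodule.coe_smul, LinearMap.add_apply, LinearMap.sub_apply,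
      LinearMap.smul_apply, LinearMap.compr₂_apply, LinearMap.compl₁₂_apply, LinearMap.id_apply,
      LinearMap.comp_smul, LinearMap.smul_comp, map_add, map_smul, mapCoeff_add, mapCoeff_smul,
      smul_add, smul_sub, RingHom.id_apply]

/-- The part `∑ (-1)^{i+1} [(φ p_i)_{l_i} f(p₁, p̂_i, p₃)]` of a differential of `f ∈ C²(L, L)`,
where `(l₁, l₂, l₃) = (l, m, -∂ - l - m)`. -/
def actionPart (φ : L →ₗ[ℂ] L) (f : A.C2) (l m : ℂ) (p q r : L) : L :=
  ev l (A.br (φ p) (ev m (f.val q r))) - ev m (A.br (φ q) (ev l (f.val p r)))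
    + evNeg A.D (l + m) (A.br (φ r) (ev l (f.val p q)))

/-- The part `∑_{i<j} (-1)^{i+j} f_{l_i + l_j}(β_{l_i}(p_i, p_j), p_k)` of a differential of
`f ∈ C²(L, L)`, for a bilinear `β_l : L × L → L`, where `(l₁, l₂, l₃) = (l, m, -∂ - l - m)`;
thus `l₁ + l₃ = -∂ - m` and `l₂ + l₃ = -∂ - l`. -/
def insertPart (β : ℂ → L → L → L) (f : A.C2) (l m : ℂ) (p q r : L) : L :=
  -ev (l + m) (f.val (β l p q) r) + evNeg A.D m (f.val (β l p r) q)
    - evNeg A.D l (f.val (β m q r) p)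

/-- The deformed bracket `[p_l q]_N = [N(p)_l q] + [p_l N(q)] - N([p_l q])`. -/
def brN (N : A.C1) (l : ℂ) (p q : L) : L :=
  ev l (A.br (N.1 p) q) + ev l (A.br p (N.1 q)) - N.1 (ev l (A.br p q))

/-- The differential `d_N` on `C²(L, L)`. The 3-cochain `d_N f` is recorded through its values
`(d_N f)_{l, m}(p, q, r)`, which determine it, in the space of all functions of
`l, m, p, q, r`. -/
def d2 (N : A.C1) : A.C2 →ₗ[ℂ] (ℂ → ℂ → L → L → L → L) where
  toFun f l m p q r :=
    A.actionPart N.1 f l m p q r + A.insertPart (A.brN N) f l m p q r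
      - N.1 (A.actionPart LinearMap.id f l m p q r
        + A.insertPart (fun l p q => ev l (A.br p q)) f l m p q r)
  map_add' f g := by
    funext l m p q r
    simp only [actionPart, insertPart, C2.val_add, LinearMap.add_apply, map_add,
      Pi.add_apply, map_sub, map_neg]
    abel
  map_smul' c f := by
    funext l m p q r
    simp only [actionPart, insertPart, C2.val_smul, LinearMap.smul_apply, map_add,
      map_smul, Pi.smul_apply, map_sub, map_neg, smul_add, smul_sub, smul_neg, RingHom.id_apply]

/-- The 2-cocycles of the complex `(C*(L, L), d_N)`. -/
def Z2 (N : A.C1) : Submodule ℂ A.C2 := LinearMap.ker (A.d2 N)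

/-- The 2-coboundaries of the complex `(C*(L, L), d_N)`. -/
def B2 (N : A.C1) : Submodule ℂ A.C2 := LinearMap.range (A.d1 N)

/-- The second cohomology `H²_N(L, L)` of the Nijenhuis operator `N`: 2-cocycles modulo
2-coboundaries (`B2 N ≤ Z2 N` when `N` is a Nijenhuis operator, since then `d_N ∘ d_N = 0`). -/
abbrev H2 (N : A.C1) : Type _ := A.Z2 N ⧸ (A.B2 N).submoduleOf (A.Z2 N)

/-- The class in `H²_N(L, L)` of a 2-cocycle. -/
def H2.mk (N : A.C1) (f : A.C2) (hf : f ∈ A.Z2 N) : A.H2 N :=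
  Submodule.Quotient.mk ⟨f, hf⟩

/-! ### Truncated power series and deformations of finite order -/

/-- The pairs `(i, j)` of exponents `≤ k` with `i + j = s`. -/
def expPairs (k s : ℕ) : Finset (Fin (k + 1) × Fin (k + 1)) :=
  Finset.univ.filter fun x => (x.1 : ℕ) + x.2 = s

theorem sum_expPairs_right {M : Type*} [AddCommMonoid M] (k s : ℕ) (hs : s < k + 1)
    (F : Fin (k + 1) → Fin (k + 1) → Fin (k + 1) → M) :
    ∑ x ∈ expPairs k s, ∑ y ∈ expPairs k x.2, F x.1 y.1 y.2 =
      ∑ z ∈ (Finset.univ : Finset (Fin (k + 1) × Fin (k + 1) × Fin (k + 1))).filter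
        (fun z => (z.1 : ℕ) + z.2.1 + z.2.2 = s), F z.1 z.2.1 z.2.2 := by
  rw [Finset.sum_sigma']
  refine Finset.sum_bij' (fun x _ => (x.1.1, x.2.1, x.2.2))
    (fun z hz => ⟨(z.1, ⟨min ((z.2.1 : ℕ) + z.2.2) k, by omega⟩), z.2⟩) ?_ ?_ ?_ ?_ ?_
  · rintro ⟨⟨a, b⟩, ⟨c, d⟩⟩ h
    simp [expPairs] at h ⊢
    omega
  · rintro ⟨a, b, c⟩ h
    simp [expPairs] at h ⊢
    omega
  · rintro ⟨⟨a, b⟩, ⟨c, d⟩⟩ h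
    simp [expPairs] at h ⊢
    apply Fin.ext
    simp
    omega
  · rintro ⟨a, b, c⟩ h
    rfl
  · rintro ⟨⟨a, b⟩, ⟨c, d⟩⟩ h
    rfl

theorem sum_expPairs_left {M : Type*} [AddCommMonoid M] (k s : ℕ) (hs : s < k + 1)
    (F : Fin (k + 1) → Fin (k + 1) → Fin (k + 1) → M) :
    ∑ x ∈ expPairs k s, ∑ y ∈ expPairs k x.1, F y.1 y.2 x.2 =
      ∑ z ∈ (Finset.univ : Finset (Fin (k + 1) × Fin (k + 1) × Fin (k + 1))).filter
        (fun z => (z.1 : ℕ) + z.2.1 + z.2.2 = s), F z.1 z.2.1 z.2.2 := by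
  rw [Finset.sum_sigma']
  refine Finset.sum_bij' (fun x _ => (x.2.1, x.2.2, x.1.2))
    (fun z hz => ⟨(⟨min ((z.1 : ℕ) + z.2.1) k, by omega⟩, z.2.2), (z.1, z.2.1)⟩) ?_ ?_ ?_ ?_ ?_
  · rintro ⟨⟨a, b⟩, ⟨c, d⟩⟩ h
    simp [expPairs] at h ⊢
    omega
  · rintro ⟨a, b, c⟩ h
    simp [expPairs] at h ⊢
    omega
  · rintro ⟨⟨a, b⟩, ⟨c, d⟩⟩ h
    simp [expPairs] at h ⊢
    apply Fin.ext
    simp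
    omega
  · rintro ⟨a, b, c⟩ h
    rfl
  · rintro ⟨⟨a, b⟩, ⟨c, d⟩⟩ h
    rfl

theorem sum_expTriples_swap {M : Type*} [AddCommMonoid M] (k s : ℕ)
    (F : Fin (k + 1) → Fin (k + 1) → Fin (k + 1) → M) :
    ∑ z ∈ (Finset.univ : Finset (Fin (k + 1) × Fin (k + 1) × Fin (k + 1))).filter
        (fun z => (z.1 : ℕ) + z.2.1 + z.2.2 = s), F z.2.1 z.1 z.2.2 =
      ∑ z ∈ (Finset.univ : Finset (Fin (k + 1) × Fin (k + 1) × Fin (k + 1))).filter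
        (fun z => (z.1 : ℕ) + z.2.1 + z.2.2 = s), F z.1 z.2.1 z.2.2 := by
  refine Finset.sum_bij' (fun z _ => (z.2.1, z.1, z.2.2)) (fun z _ => (z.2.1, z.1, z.2.2))
    ?_ ?_ ?_ ?_ ?_
  · rintro ⟨a, b, c⟩ h
    simp at h ⊢
    omega
  · rintro ⟨a, b, c⟩ h
    simp at h ⊢
    omega
  · rintro ⟨a, b, c⟩ h
    rfl
  · rintro ⟨a, b, c⟩ h
    rfl
  · rintro ⟨a, b, c⟩ h
    rfl

set_option synthInstance.maxHeartbeats 400000 in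
/-- The `ℂ[[t]]/t^{k+1}`-bilinear extension of the bracket of `L` to `L[[t]]/t^{k+1}`, where
`a : Fin (k + 1) → L` stands for `∑ i, a i t^i`: the coefficient of `t^s` in `[a_l b]` is
`∑_{i+j=s} [(a i)_l (b j)]`. -/
def truncBr (k : ℕ) :
    (Fin (k + 1) → L) →ₗ[ℂ] (Fin (k + 1) → L) →ₗ[ℂ] PolyIn (Fin (k + 1) → L) :=
  ∑ s : Fin (k + 1), ∑ x ∈ expPairs k s,
    (A.br.compl₁₂ (LinearMap.proj x.1 : (Fin (k + 1) → L) →ₗ[ℂ] L)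
      (LinearMap.proj x.2 : (Fin (k + 1) → L) →ₗ[ℂ] L)).compr₂
      (mapCoeff (LinearMap.single ℂ (fun _ : Fin (k + 1) => L) s))

theorem mapCoeff_truncBr (k : ℕ) (a b : Fin (k + 1) → L) (s : Fin (k + 1)) :
    mapCoeff (LinearMap.proj s : (Fin (k + 1) → L) →ₗ[ℂ] L) (A.truncBr k a b) =
      ∑ x ∈ expPairs k s, A.br (a x.1) (b x.2) := by
  simp only [truncBr, LinearMap.sum_apply, map_sum, LinearMap.compr₂_apply,
    LinearMap.compl₁₂_apply, LinearMap.proj_apply]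
  rw [Finset.sum_eq_single s]
  · refine Finset.sum_congr rfl fun x _ => ?_
    rw [mapCoeff_comp, LinearMap.proj_comp_single_same, mapCoeff_id]
  · intro u _ hu
    refine Finset.sum_eq_zero fun x _ => ?_
    rw [mapCoeff_comp, LinearMap.proj_comp_single_ne _ _ _ _ hu.symm, mapCoeff_zero]
  · simp

theorem ev_truncBr (k : ℕ) (l : ℂ) (a b : Fin (k + 1) → L) (s : Fin (k + 1)) :
    ev l (A.truncBr k a b) s = ∑ x ∈ expPairs k s, ev l (A.br (a x.1) (b x.2)) := by
  have h := ev_mapCoeff (LinearMap.proj s : (Fin (k + 1) → L) →ₗ[ℂ] L) l (A.truncBr k a b)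
  rw [mapCoeff_truncBr, map_sum] at h
  exact h.symm

theorem evNeg_truncBr (k : ℕ) (l : ℂ) (a b : Fin (k + 1) → L) (s : Fin (k + 1)) :
    evNeg (A.D.compLeft (Fin (k + 1))) l (A.truncBr k a b) s =
      ∑ x ∈ expPairs k s, evNeg A.D l (A.br (a x.1) (b x.2)) := by
  have h := evNeg_mapCoeff (LinearMap.proj s : (Fin (k + 1) → L) →ₗ[ℂ] L)
    (A.D.compLeft (Fin (k + 1))) A.D (fun x => rfl) l (A.truncBr k a b)
  rw [mapCoeff_truncBr, map_sum] at h
  exact h.symm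

/-- The Lie conformal algebra `L[[t]]/t^{k+1}`, with `∂` and the bracket extended
`ℂ[[t]]/t^{k+1}`-linearly. -/
def trunc (k : ℕ) : LieConformalAlgebra (Fin (k + 1) → L) where
  D := A.D.compLeft (Fin (k + 1))
  br := A.truncBr k
  isTwoCochain := by
    refine ⟨fun l p q => ?_, fun l p q => ?_, fun l p q => ?_⟩
    · funext s
      simp [ev_truncBr, A.isTwoCochain.left, Finset.smul_sum]
    · funext s
      simp [ev_truncBr, A.isTwoCochain.right, Finset.smul_sum, Finset.sum_add_distrib]
    · funext s
      rw [Pi.neg_apply, ev_truncBr, evNeg_truncBr, ← Finset.sum_neg_distrib]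
      refine Finset.sum_bij' (fun x _ => x.swap) (fun x _ => x.swap) ?_ ?_ ?_ ?_ ?_
      · rintro ⟨a, b⟩ h
        simp [expPairs] at h ⊢
        omega
      · rintro ⟨a, b⟩ h
        simp [expPairs] at h ⊢
        omega
      · intro x _
        rfl
      · intro x _
        rfl
      · intro x _
        exact A.isTwoCochain.skew l _ _
  jacobi := by
    intro l m p q r
    funext s
    rw [Pi.add_apply]
    simp only [ev_truncBr, map_sum, LinearMap.sum_apply]
    rw [sum_expPairs_right k s s.2 (fun i u v => ev l (A.br (p i) (ev m (A.br (q u) (r v))))),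
      sum_expPairs_left k s s.2
        (fun i u v => ev (l + m) (A.br (ev l (A.br (p i) (q u))) (r v))),
      sum_expPairs_right k s s.2 (fun u i v => ev m (A.br (q u) (ev l (A.br (p i) (r v))))),
      ← sum_expTriples_swap k s
        (fun u i v => ev m (A.br (q u) (ev l (A.br (p i) (r v))))),
      ← Finset.sum_add_distrib]
    exact Finset.sum_congr rfl fun z _ => A.jacobi l m _ _ _

/-- The `ℂ[[t]]/t^{k+1}`-linear map `∑ i, N i t^i` on `L[[t]]/t^{k+1}`: the coefficient of `t^s`
in the image of `a` is `∑_{i+j=s} N i (a j)`. -/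
def seriesMap {k : ℕ} (N : Fin (k + 1) → A.C1) : (A.trunc k).C1 where
  val := LinearMap.pi fun s =>
    ∑ x ∈ expPairs k s, (N x.1).1 ∘ₗ (LinearMap.proj x.2 : (Fin (k + 1) → L) →ₗ[ℂ] L)
  property := by
    intro p
    funext s
    have h : ∀ i x, (N i).1 (A.D x) = A.D ((N i).1 x) := fun i x => (N i).2 x
    simp [trunc, h]

/-- A deformation of order `k` of the operator `N`: maps `N₀ = N, N₁, …, N_k ∈ C¹(L, L)` such that
`∑ i, N_i t^i` is a Nijenhuis operator on `L[[t]]/t^{k+1}`. -/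
structure Deformation (N : A.C1) (k : ℕ) where
  coeff : Fin (k + 1) → A.C1
  coeff_zero : coeff 0 = N
  isNijenhuis : (A.trunc k).IsNijenhuis (A.seriesMap coeff)

/-- A deformation of order `k` is extensible if a term `N_{k+1} t^{k+1}` can be added to obtain a
deformation of order `k + 1`. -/
def Deformation.Extensible {A : LieConformalAlgebra L} {N : A.C1} {k : ℕ}
    (T : A.Deformation N k) : Prop :=
  ∃ T' : A.Deformation N (k + 1), ∀ i : Fin (k + 1), T'.coeff i.castSucc = T.coeff i

/-- The obstruction `-½ ∑ [N_i, N_j]` of a deformation of order `k`, summed over the `i, j` with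
`i + j = k + 1`, `1 ≤ i` and `1 ≤ j`. -/
def Deformation.obstruction {A : LieConformalAlgebra L} {N : A.C1} {k : ℕ}
    (T : A.Deformation N k) : A.C2 :=
  (-(1 / 2) : ℂ) •
    ∑ x ∈ (expPairs k (k + 1)).filter (fun x => 1 ≤ (x.1 : ℕ) ∧ 1 ≤ (x.2 : ℕ)),
      A.fn (T.coeff x.1) (T.coeff x.2)

end LieConformalAlgebra

end LieConformal

end

/-! The Nijenhuis condition is a Maurer–Cartan equation: for a series N_t = ∑ N_i t^i, being a
Nijenhuis operator modulo t^{k+1} means that the coefficients of [N_t, N_t]_FN vanish up to order k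
(`isNijenhuis_seriesMap_iff`). If this holds up to order n, the next coefficient is 2(d_N N_{n+1} -
Ob), because the only terms containing N_{n+1} are [N, N_{n+1}] and [N_{n+1}, N] (`fnCoeff_succ`).
So a term N_{n+1} extends the deformation exactly when d_N N_{n+1} = Ob, that is, when Ob is a
coboundary.

The cocycle property comes from the Bianchi identity [N_t, [N_t, N_t]] = 0. In order n + 1
(`sum_d2_fnCoeff`), all coefficients of [N_t, N_t] of order at most n drop out, and d_N applied to
the coefficient of order n + 1 remains. The identity [J, [J, J]] = 0 holds for every 1-cochain J
(`d2_fn_self`) as a direct consequence of the conformal Jacobi identity; its polarisation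
`d2_fn_cyclic` yields the coefficients of the series version. -/

noncomputable section

namespace LieConformal

/-! ### Polynomials and their values -/

/-- A polynomial over an infinite field is determined by its values. -/
theorem ext_ev {M : Type*} [AddCommGroup M] [Module ℂ M] {a b : PolyIn M}
    (h : ∀ l, ev l a = ev l b) : a = b := by
  rw [← sub_eq_zero]
  set c := a - b with hc
  have h0 : ∀ l, ev l c = 0 := fun l => by rw [hc, map_sub, h l, sub_self]
  -- A linear functional turns the vector-valued polynomial into an ordinary one over ℂ, where
  -- vanishing at all scalars forces it to be zero.
  have key : ∀ φ : M →ₗ[ℂ] ℂ, mapCoeff φ c = 0 := by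
    intro φ
    apply PolynomialModule.equivPolynomialSelf.injective
    rw [map_zero]
    apply Polynomial.funext
    intro l
    have h1 : ∀ x : PolyIn ℂ,
        (PolynomialModule.equivPolynomialSelf x).eval l = ev l x := by
      intro x
      induction x using PolynomialModule.induction_linear with
      | zero => simp
      | add a b ha hb => simp only [map_add, Polynomial.eval_add, ha, hb]
      | single k x =>
        simp [ev, mul_comm]
    rw [h1, ev_mapCoeff, h0]
    simp
  have hcoeff : ∀ (φ : M →ₗ[ℂ] ℂ) (x : PolyIn M) (k : ℕ),
      (mapCoeff φ x).coeff k = φ (x.coeff k) := by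
    intro φ x k
    induction x using PolynomialModule.induction_linear with
    | zero => simp
    | add a b ha hb =>
      rw [map_add, PolynomialModule.coeff_add, Finsupp.add_apply, ha, hb,
        PolynomialModule.coeff_add, Finsupp.add_apply, map_add]
    | single i x =>
      rw [mapCoeff_single, PolynomialModule.coeff_single, PolynomialModule.coeff_single,
        Finsupp.single_apply, Finsupp.single_apply, apply_ite φ, map_zero]
  apply PolynomialModule.coeff_injective
  ext k
  -- Functionals separate the points of a vector space, so each coefficient vanishes.
  refine (Module.forall_dual_apply_eq_zero_iff ℂ _).mp fun φ => ?_
  rw [← hcoeff, key φ]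
  simp

namespace LieConformalAlgebra

open Finset

variable {L : Type*} [AddCommGroup L] [Module ℂ L] (A : LieConformalAlgebra L)

/-! ### The Frölicher–Nijenhuis bracket and its graded Jacobi identity -/

theorem ev_fn (J K : A.C1) (l : ℂ) (p q : L) :
    ev l ((A.fn J K).val p q) =
      ev l (A.br (J.1 p) (K.1 q)) + ev l (A.br (K.1 p) (J.1 q))
        + (J.1 (K.1 (ev l (A.br p q))) + K.1 (J.1 (ev l (A.br p q))))
        - (K.1 (ev l (A.br (J.1 p) q)) + K.1 (ev l (A.br p (J.1 q))))
        - (J.1 (ev l (A.br (K.1 p) q)) + J.1 (ev l (A.br p (K.1 q)))) := by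
  simp only [fn_val, fnBilin, br₂, LinearMap.add_apply, LinearMap.sub_apply,
    LinearMap.compr₂_apply, LinearMap.compl₁₂_apply, LinearMap.id_apply, map_add, map_sub,
    ev_mapCoeff, LinearMap.comp_apply]

theorem fn_comm (J K : A.C1) : A.fn J K = A.fn K J := by
  apply C2.ext
  ext1 p
  ext1 q
  apply ext_ev
  intro l
  rw [ev_fn, ev_fn]
  abel

theorem C2.isTwoCochain {A : LieConformalAlgebra L} (f : A.C2) : IsTwoCochain A.D f.val :=
  Subtype.property (p := fun f => f ∈ A.twoCochains) f

theorem evNeg_br (l : ℂ) (p q : L) : evNeg A.D l (A.br p q) = -ev l (A.br q p) := by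
  rw [A.isTwoCochain.skew l q p, neg_neg]

theorem C2.evNeg_val {A : LieConformalAlgebra L} (f : A.C2) (l : ℂ) (p q : L) :
    evNeg A.D l (f.val p q) = -ev l (f.val q p) := by
  rw [f.isTwoCochain.skew l q p, neg_neg]

/-- The differential on 2-cochains, written without the substitution of `-∂ - l`. -/
theorem d2_apply (N : A.C1) (f : A.C2) (l m : ℂ) (p q r : L) :
    A.d2 N f l m p q r =
      ev l (A.br (N.1 p) (ev m (f.val q r))) - ev m (A.br (N.1 q) (ev l (f.val p r)))
        - ev (l + m) (A.br (ev l (f.val p q)) (N.1 r))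
        - ev (l + m) (f.val (A.brN N l p q) r) - ev m (f.val q (A.brN N l p r))
        + ev l (f.val p (A.brN N m q r))
        - N.1 (ev l (A.br p (ev m (f.val q r))) - ev m (A.br q (ev l (f.val p r)))
          - ev (l + m) (A.br (ev l (f.val p q)) r)
          - ev (l + m) (f.val (ev l (A.br p q)) r) - ev m (f.val q (ev l (A.br p r)))
          + ev l (f.val p (ev m (A.br q r)))) := by
  change A.actionPart N.1 f l m p q r + A.insertPart (A.brN N) f l m p q r
      - N.1 (A.actionPart LinearMap.id f l m p q r
        + A.insertPart (fun l p q => ev l (A.br p q)) f l m p q r) = _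
  -- Skew-symmetry removes every substitution of -∂ - l, so that the Jacobi identity, stated for
  -- scalar values, applies to all terms.
  simp only [actionPart, insertPart, evNeg_br, C2.evNeg_val, LinearMap.id_apply, map_add, map_sub,
    map_neg]
  abel

/-- The graded Jacobi identity `[J, [J, J]] = 0` for the Frölicher-Nijenhuis bracket. -/
theorem d2_fn_self (J : A.C1) : A.d2 J (A.fn J J) = 0 := by
  funext l m p q r
  rw [d2_apply]
  simp only [ev_fn, brN, map_add, map_sub, LinearMap.add_apply, LinearMap.sub_apply,
    Pi.zero_apply]
  -- Expanding every [·_l [·_m ·]] by the Jacobi identity gives a normal form in which all terms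
  -- cancel.
  simp only [A.jacobi l m, map_add]
  abel

/-- Additivity in the operator, for arbitrary 1-cochains, is what allows [J, [J, J]] = 0 to be
polarised. -/
theorem d2_add_left (J K : A.C1) (f : A.C2) : A.d2 (J + K) f = A.d2 J f + A.d2 K f := by
  funext l m p q r
  simp only [d2_apply, brN, Pi.add_apply, Submodule.coe_add, LinearMap.add_apply, map_add, map_sub,
    LinearMap.sub_apply]
  abel

theorem fn_add_right (J K M : A.C1) : A.fn J (K + M) = A.fn J K + A.fn J M :=
  map_add (A.d1 J) K M

theorem fn_add_left (J K M : A.C1) : A.fn (J + K) M = A.fn J M + A.fn K M := by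
  rw [fn_comm, fn_add_right, fn_comm A M J, fn_comm A M K]

/-- The graded Jacobi identity for three 1-cochains. -/
theorem d2_fn_cyclic (J K M : A.C1) :
    A.d2 J (A.fn K M) + A.d2 K (A.fn J M) + A.d2 M (A.fn J K) = 0 := by
  have h := A.d2_fn_self
  have h1 := h (J + K + M)
  have h2 := h (J + K)
  have h3 := h (J + M)
  have h4 := h (K + M)
  have e1 := h J
  have e2 := h K
  have e3 := h M
  simp only [fn_add_right, fn_add_left, d2_add_left, map_add, A.fn_comm K J, A.fn_comm M J,
    A.fn_comm M K] at h1 h2 h3 h4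
  have : (2 : ℂ) • (A.d2 J (A.fn K M) + A.d2 K (A.fn J M) + A.d2 M (A.fn J K)) = 0 := by
    -- Inclusion–exclusion isolates the part of the cubic identity that is linear in each of J, K,
    -- M; the symmetry of the bracket produces the factor 2.
    linear_combination (norm := module) h1 - h2 - h3 - h4 + e1 + e2 + e3
  exact (smul_eq_zero.mp this).resolve_left two_ne_zero

/-! ### Sums over exponents -/

theorem C2.val_sum {ι : Type*} (s : Finset ι) (f : ι → A.C2) (p q : L) :
    (∑ i ∈ s, f i).val p q = ∑ i ∈ s, (f i).val p q := by
  classical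
  induction s using Finset.induction_on with
  | empty => rfl
  | insert a s ha ih => rw [sum_insert ha, sum_insert ha, C2.val_add, LinearMap.add_apply,
      LinearMap.add_apply, ih]

/-- For s ≤ k the bound on the exponents is automatic, so truncated sums can be handled with series
indexed by ℕ. -/
theorem sum_expPairs {M : Type*} [AddCommMonoid M] {k s : ℕ} (hs : s ≤ k) (F : ℕ → ℕ → M) :
    ∑ x ∈ expPairs k s, F x.1 x.2 = ∑ x ∈ antidiagonal s, F x.1 x.2 := by
  refine Finset.sum_bij' (fun x _ => ((x.1 : ℕ), (x.2 : ℕ)))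
    (fun x hx => (⟨x.1, by simp at hx; omega⟩, ⟨x.2, by simp at hx; omega⟩)) ?_ ?_ ?_ ?_ ?_
  · rintro ⟨a, b⟩ h
    simpa [expPairs] using h
  · rintro ⟨a, b⟩ h
    simpa [expPairs] using h
  · rintro ⟨a, b⟩ h
    rfl
  · rintro ⟨a, b⟩ h
    rfl
  · rintro ⟨a, b⟩ h
    rfl

section Rearrange

variable {M : Type*} [AddCommMonoid M] (s : ℕ) (F : ℕ → ℕ → ℕ → ℕ → M)

/-- This and the next three lemmas compare two groupings of the quadruples of sum s. On the right
the first pair will index operators and the second pair vectors; each left side is the grouping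
produced by one term of the Nijenhuis identity. -/
theorem sum_antidiagonal_exchange :
    ∑ x ∈ antidiagonal s, ∑ y ∈ antidiagonal x.1, ∑ z ∈ antidiagonal x.2, F y.1 y.2 z.1 z.2 =
      ∑ x ∈ antidiagonal s, ∑ y ∈ antidiagonal x.1, ∑ z ∈ antidiagonal x.2,
        F y.1 z.1 y.2 z.2 := by
  simp only [sum_sigma']
  refine Finset.sum_bij'
    (fun x _ => ⟨(x.2.1.1 + x.2.2.1, x.2.1.2 + x.2.2.2), (x.2.1.1, x.2.2.1), (x.2.1.2, x.2.2.2)⟩)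
    (fun x _ => ⟨(x.2.1.1 + x.2.2.1, x.2.1.2 + x.2.2.2), (x.2.1.1, x.2.2.1), (x.2.1.2, x.2.2.2)⟩)
    ?_ ?_ ?_ ?_ ?_
  all_goals
    rintro ⟨⟨a, b⟩, ⟨c, d⟩, ⟨e, f⟩⟩ h
    simp at h ⊢
    try omega

theorem sum_antidiagonal_right_left :
    ∑ x ∈ antidiagonal s, ∑ y ∈ antidiagonal x.2, ∑ z ∈ antidiagonal y.1, F x.1 z.1 z.2 y.2 =
      ∑ x ∈ antidiagonal s, ∑ y ∈ antidiagonal x.1, ∑ z ∈ antidiagonal x.2,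
        F y.1 y.2 z.1 z.2 := by
  simp only [sum_sigma']
  refine Finset.sum_bij'
    (fun x _ => ⟨(x.1.1 + x.2.2.1, x.2.2.2 + x.2.1.2), (x.1.1, x.2.2.1), (x.2.2.2, x.2.1.2)⟩)
    (fun x _ => ⟨(x.2.1.1, x.2.1.2 + x.2.2.1 + x.2.2.2), (x.2.1.2 + x.2.2.1, x.2.2.2),
      (x.2.1.2, x.2.2.1)⟩)
    ?_ ?_ ?_ ?_ ?_
  all_goals
    rintro ⟨⟨a, b⟩, ⟨c, d⟩, ⟨e, f⟩⟩ h
    simp at h ⊢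
    try omega

theorem sum_antidiagonal_right_right :
    ∑ x ∈ antidiagonal s, ∑ y ∈ antidiagonal x.2, ∑ z ∈ antidiagonal y.2, F x.1 y.1 z.1 z.2 =
      ∑ x ∈ antidiagonal s, ∑ y ∈ antidiagonal x.1, ∑ z ∈ antidiagonal x.2,
        F y.1 y.2 z.1 z.2 := by
  simp only [sum_sigma']
  refine Finset.sum_bij'
    (fun x _ => ⟨(x.1.1 + x.2.1.1, x.2.2.1 + x.2.2.2), (x.1.1, x.2.1.1), (x.2.2.1, x.2.2.2)⟩)
    (fun x _ => ⟨(x.2.1.1, x.2.1.2 + x.2.2.1 + x.2.2.2), (x.2.1.2, x.2.2.1 + x.2.2.2),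
      (x.2.2.1, x.2.2.2)⟩)
    ?_ ?_ ?_ ?_ ?_
  all_goals
    rintro ⟨⟨a, b⟩, ⟨c, d⟩, ⟨e, f⟩⟩ h
    simp at h ⊢
    try omega

theorem sum_antidiagonal_right_mid :
    ∑ x ∈ antidiagonal s, ∑ y ∈ antidiagonal x.2, ∑ z ∈ antidiagonal y.2, F x.1 z.1 y.1 z.2 =
      ∑ x ∈ antidiagonal s, ∑ y ∈ antidiagonal x.1, ∑ z ∈ antidiagonal x.2,
        F y.1 y.2 z.1 z.2 := by
  simp only [sum_sigma']
  refine Finset.sum_bij'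
    (fun x _ => ⟨(x.1.1 + x.2.2.1, x.2.1.1 + x.2.2.2), (x.1.1, x.2.2.1), (x.2.1.1, x.2.2.2)⟩)
    (fun x _ => ⟨(x.2.1.1, x.2.1.2 + x.2.2.1 + x.2.2.2), (x.2.2.1, x.2.1.2 + x.2.2.2),
      (x.2.1.2, x.2.2.2)⟩)
    ?_ ?_ ?_ ?_ ?_
  all_goals
    rintro ⟨⟨a, b⟩, ⟨c, d⟩, ⟨e, f⟩⟩ h
    simp at h ⊢
    try omega

/-- The sum runs over all triples of sum s, hence is invariant under permuting the exponents; this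
serves the three terms of the cyclic identity. -/
theorem sum_antidiagonal_triple_swap (G : ℕ → ℕ → ℕ → M) :
    ∑ x ∈ antidiagonal s, ∑ y ∈ antidiagonal x.2, G y.1 x.1 y.2 =
      ∑ x ∈ antidiagonal s, ∑ y ∈ antidiagonal x.2, G x.1 y.1 y.2 := by
  simp only [sum_sigma']
  refine Finset.sum_bij'
    (fun x _ => ⟨(x.2.1, x.1.1 + x.2.2), (x.1.1, x.2.2)⟩)
    (fun x _ => ⟨(x.2.1, x.1.1 + x.2.2), (x.1.1, x.2.2)⟩) ?_ ?_ ?_ ?_ ?_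
  all_goals
    rintro ⟨⟨a, b⟩, ⟨c, d⟩⟩ h
    simp at h ⊢
    try omega

theorem sum_antidiagonal_triple_rotate (G : ℕ → ℕ → ℕ → M) :
    ∑ x ∈ antidiagonal s, ∑ y ∈ antidiagonal x.2, G y.2 x.1 y.1 =
      ∑ x ∈ antidiagonal s, ∑ y ∈ antidiagonal x.2, G x.1 y.1 y.2 := by
  rw [← sum_antidiagonal_triple_swap s G]
  refine sum_congr rfl fun x _ => ?_
  exact Finset.Nat.sum_antidiagonal_swap (f := fun y => G y.1 x.1 y.2)

end Rearrange

/-! ### The Nijenhuis condition on truncated series -/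

/-- The coefficient of `t^s` of the Frölicher-Nijenhuis square of a series. -/
def fnCoeff (N : ℕ → A.C1) (s : ℕ) : A.C2 :=
  ∑ x ∈ antidiagonal s, A.fn (N x.1) (N x.2)

/-- The terms `[N_i(p)_l N_j(q)] - N_i([N_j(p)_l q] + [p_l N_j(q)]) + N_i(N_j([p_l q]))`, whose sum over
`i + j = s` is half the coefficient of `t^s` of `[N, N]`. -/
def torsionTerm (N : ℕ → A.C1) (l : ℂ) (p q : L) (i j : ℕ) : L :=
  ev l (A.br ((N i).1 p) ((N j).1 q)) - (N i).1 (ev l (A.br ((N j).1 p) q))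
    - (N i).1 (ev l (A.br p ((N j).1 q))) + (N i).1 ((N j).1 (ev l (A.br p q)))

theorem ev_fnCoeff (N : ℕ → A.C1) (s : ℕ) (l : ℂ) (p q : L) :
    ev l ((A.fnCoeff N s).val p q) =
      (2 : ℂ) • ∑ x ∈ antidiagonal s, A.torsionTerm N l p q x.1 x.2 := by
  have hsw := Finset.Nat.sum_antidiagonal_swap (n := s)
    (f := fun x => A.torsionTerm N l p q x.1 x.2)
  rw [two_smul]
  -- The bracket of N_i and N_j is the sum of the terms for (i, j) and (j, i), so one of the two
  -- copies is summed in swapped order.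
  nth_rewrite 1 [← hsw]
  rw [fnCoeff, C2.val_sum, map_sum, ← sum_add_distrib]
  refine sum_congr rfl fun x _ => ?_
  rw [ev_fn]
  simp only [torsionTerm, Prod.fst_swap, Prod.snd_swap]
  abel

theorem ev_trunc_br (k : ℕ) (l : ℂ) (a b : ℕ → L) {s : ℕ} (hs : s < k + 1) :
    ev l ((A.trunc k).br (fun i => a i) (fun i => b i)) ⟨s, hs⟩ =
      ∑ x ∈ antidiagonal s, ev l (A.br (a x.1) (b x.2)) := by
  rw [← sum_expPairs (Nat.lt_succ_iff.mp hs) (fun i j => ev l (A.br (a i) (b j)))]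
  exact A.ev_truncBr k l _ _ ⟨s, hs⟩

/-- The Cauchy product of a series of operators and a series of vectors. -/
def conv (N : ℕ → A.C1) (a : ℕ → L) (s : ℕ) : L :=
  ∑ x ∈ antidiagonal s, (N x.1).1 (a x.2)

/-- The Cauchy product of two series of vectors for the bracket. -/
def convBr (l : ℂ) (a b : ℕ → L) (s : ℕ) : L :=
  ∑ x ∈ antidiagonal s, ev l (A.br (a x.1) (b x.2))

theorem ev_trunc_br_eq_convBr (k : ℕ) (l : ℂ) (a b : ℕ → L) :
    ev l ((A.trunc k).br (fun i => a i) (fun i => b i)) = fun i : Fin (k + 1) => A.convBr l a b i := by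
  funext s
  exact A.ev_trunc_br k l a b s.2

theorem seriesMap_apply (k : ℕ) (N : ℕ → A.C1) (a : ℕ → L) :
    (A.seriesMap (k := k) (fun i => N i)).1 (fun i => a i) = fun i : Fin (k + 1) => A.conv N a i := by
  funext s
  rw [conv, ← sum_expPairs (Nat.lt_succ_iff.mp s.2) (fun i j => (N i).1 (a j))]
  simp [seriesMap]

/-- The torsion of a series of operators is bilinear over power series in t, so its coefficients are
determined by the torsion terms on coefficients of the vectors. -/
theorem convBr_conv_conv (N : ℕ → A.C1) (l : ℂ) (a b : ℕ → L) (s : ℕ) :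
    A.convBr l (A.conv N a) (A.conv N b) s
      - (A.conv N (A.convBr l (A.conv N a) b) s + A.conv N (A.convBr l a (A.conv N b)) s
        - A.conv N (A.conv N (A.convBr l a b)) s) =
      ∑ x ∈ antidiagonal s, ∑ z ∈ antidiagonal x.2, ∑ y ∈ antidiagonal x.1,
        A.torsionTerm N l (a z.1) (b z.2) y.1 y.2 := by
  have h1 : A.convBr l (A.conv N a) (A.conv N b) s =
      ∑ x ∈ antidiagonal s, ∑ y ∈ antidiagonal x.1, ∑ z ∈ antidiagonal x.2,
        ev l (A.br ((N y.1).1 (a z.1)) ((N y.2).1 (b z.2))) := by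
    rw [← sum_antidiagonal_exchange s
      (fun i u j v => ev l (A.br ((N i).1 (a u)) ((N j).1 (b v))))]
    simp only [convBr, conv, map_sum, LinearMap.sum_apply]
    exact sum_congr rfl fun x _ => sum_comm
  have h2 : A.conv N (A.convBr l (A.conv N a) b) s =
      ∑ x ∈ antidiagonal s, ∑ y ∈ antidiagonal x.1, ∑ z ∈ antidiagonal x.2,
        (N y.1).1 (ev l (A.br ((N y.2).1 (a z.1)) (b z.2))) := by
    rw [← sum_antidiagonal_right_left s
      (fun i j u v => (N i).1 (ev l (A.br ((N j).1 (a u)) (b v))))]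
    simp only [convBr, conv, map_sum, LinearMap.sum_apply]
  have h3 : A.conv N (A.convBr l a (A.conv N b)) s =
      ∑ x ∈ antidiagonal s, ∑ y ∈ antidiagonal x.1, ∑ z ∈ antidiagonal x.2,
        (N y.1).1 (ev l (A.br (a z.1) ((N y.2).1 (b z.2)))) := by
    rw [← sum_antidiagonal_right_mid s
      (fun i j u v => (N i).1 (ev l (A.br (a u) ((N j).1 (b v)))))]
    simp only [convBr, conv, map_sum]
  have h4 : A.conv N (A.conv N (A.convBr l a b)) s =
      ∑ x ∈ antidiagonal s, ∑ y ∈ antidiagonal x.1, ∑ z ∈ antidiagonal x.2,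
        (N y.1).1 ((N y.2).1 (ev l (A.br (a z.1) (b z.2)))) := by
    rw [← sum_antidiagonal_right_right s
      (fun i j u v => (N i).1 ((N j).1 (ev l (A.br (a u) (b v)))))]
    simp only [convBr, conv, map_sum]
  rw [h1, h2, h3, h4]
  simp only [← sum_add_distrib, ← sum_sub_distrib]
  refine sum_congr rfl fun x _ => ?_
  rw [sum_comm]
  refine sum_congr rfl fun z _ => sum_congr rfl fun y _ => ?_
  rw [torsionTerm]
  abel

/-- The truncation of a series `∑ i, N i t^i` is a Nijenhuis operator on `L[[t]]/t^{k+1}` if and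
only if the coefficients of `[N, N]` vanish up to order `k`. -/
theorem isNijenhuis_seriesMap_iff (k : ℕ) (N : ℕ → A.C1) :
    (A.trunc k).IsNijenhuis (A.seriesMap (k := k) fun i => N i) ↔
      ∀ s ≤ k, A.fnCoeff N s = 0 := by
  have hser : (A.trunc k).IsNijenhuis (A.seriesMap (k := k) fun i => N i) ↔
      ∀ (l : ℂ) (a b : ℕ → L), ∀ s ≤ k,
        ∑ x ∈ antidiagonal s, ∑ z ∈ antidiagonal x.2, ∑ y ∈ antidiagonal x.1,
          A.torsionTerm N l (a z.1) (b z.2) y.1 y.2 = 0 := by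
    have hext : ∀ a : Fin (k + 1) → L, ∃ a' : ℕ → L, a = fun i : Fin (k + 1) => a' i := by
      intro a
      -- Continuation by zero; entries beyond order k do not affect the truncation.
      refine ⟨fun i => if h : i < k + 1 then a ⟨i, h⟩ else 0, ?_⟩
      funext i
      change a i = if h : (i : ℕ) < k + 1 then a ⟨i, h⟩ else 0
      rw [dif_pos i.2]
    have hcomp : ∀ (l : ℂ) (a b : ℕ → L), (
        ev l ((A.trunc k).br ((A.seriesMap (k := k) fun i => N i).1 fun i => a i)
          ((A.seriesMap (k := k) fun i => N i).1 fun i => b i)) =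
        (A.seriesMap (k := k) fun i => N i).1
          (ev l ((A.trunc k).br ((A.seriesMap (k := k) fun i => N i).1 fun i => a i) fun i => b i)
          + ev l ((A.trunc k).br (fun i => a i) ((A.seriesMap (k := k) fun i => N i).1 fun i => b i))
          - (A.seriesMap (k := k) fun i => N i).1
              (ev l ((A.trunc k).br (fun i => a i) (fun i => b i))))) ↔
        ∀ s ≤ k, ∑ x ∈ antidiagonal s, ∑ z ∈ antidiagonal x.2, ∑ y ∈ antidiagonal x.1,
          A.torsionTerm N l (a z.1) (b z.2) y.1 y.2 = 0 := by
      intro l a b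
      rw [map_sub, map_add]
      simp only [seriesMap_apply, ev_trunc_br_eq_convBr, ← convBr_conv_conv]
      rw [funext_iff]
      constructor
      · intro h s hs
        exact sub_eq_zero.mpr (h ⟨s, Nat.lt_succ_iff.mpr hs⟩)
      · intro h s
        exact sub_eq_zero.mp (h s (Nat.lt_succ_iff.mp s.2))
    constructor
    · intro h l a b
      exact (hcomp l a b).mp (h l _ _)
    · intro h l p q
      obtain ⟨a, rfl⟩ := hext p
      obtain ⟨b, rfl⟩ := hext q
      exact (hcomp l a b).mpr (h l a b)
  rw [hser]
  constructor
  · intro h s hs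
    apply C2.ext
    ext1 p
    ext1 q
    apply ext_ev
    intro l
    rw [ev_fnCoeff]
    refine Eq.trans ?_ (map_zero (ev l)).symm
    -- Testing on the constant series p and q leaves just the coefficient of order s of the torsion,
    -- evaluated at p and q.
    have h1 := h l (Pi.single 0 p) (Pi.single 0 q) s hs
    have ht : ∀ (i j : ℕ) (z : ℕ × ℕ), z ≠ (0, 0) → A.torsionTerm N l
        ((Pi.single 0 p : ℕ → L) z.1) ((Pi.single 0 q : ℕ → L) z.2) i j = 0 := by
      rintro i j ⟨u, v⟩ hz
      rcases Nat.eq_zero_or_pos u with rfl | hu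
      · have hv : v ≠ 0 := fun hv => hz (by rw [hv])
        simp [torsionTerm, hv]
      · simp [torsionTerm, hu.ne']
    rw [sum_eq_single (s, 0)] at h1
    · simp only [Nat.antidiagonal_zero, sum_singleton, Pi.single_eq_same] at h1
      rw [h1, smul_zero]
    · rintro ⟨i, j⟩ hij hne
      have hij' := mem_antidiagonal.mp hij
      refine sum_eq_zero fun z hz => sum_eq_zero fun y _ => ht _ _ _ ?_
      rintro rfl
      have hz' := mem_antidiagonal.mp hz
      apply hne
      ext <;> simp at * <;> omega
    · simp
  · intro h l a b s hs
    -- Each innermost sum is half the value of a coefficient of [N, N] of order x.1 ≤ s ≤ k.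
    refine sum_eq_zero fun x hx => sum_eq_zero fun z _ => ?_
    have hx' := mem_antidiagonal.mp hx
    have h1 := A.ev_fnCoeff N x.1 l (a z.1) (b z.2)
    rw [h x.1 (by omega)] at h1
    have h2 : ev l ((0 : A.C2).val (a z.1) (b z.2)) = 0 := map_zero (ev l)
    rw [h2] at h1
    exact (smul_eq_zero.mp h1.symm).resolve_left two_ne_zero

/-! ### The Bianchi identity and the obstruction -/

/-- The coefficient of `t^s` in the graded Jacobi identity `[N, [N, N]] = 0`. -/
theorem sum_d2_fnCoeff (N : ℕ → A.C1) (s : ℕ) :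
    ∑ x ∈ antidiagonal s, A.d2 (N x.1) (A.fnCoeff N x.2) = 0 := by
  simp only [fnCoeff, map_sum]
  have h1 := sum_antidiagonal_triple_swap s fun i j k => A.d2 (N i) (A.fn (N j) (N k))
  have h2 := sum_antidiagonal_triple_rotate s fun i j k => A.d2 (N i) (A.fn (N j) (N k))
  have h3 : (3 : ℂ) • ∑ x ∈ antidiagonal s, ∑ y ∈ antidiagonal x.2,
      A.d2 (N x.1) (A.fn (N y.1) (N y.2)) = 0 := by
    -- Three copies of the sum, relabelled so that each exponent in turn indexes the outer operator,
    -- add up termwise to the cyclic identity.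
    have h4 : (3 : ℂ) • ∑ x ∈ antidiagonal s, ∑ y ∈ antidiagonal x.2,
        A.d2 (N x.1) (A.fn (N y.1) (N y.2)) =
        ∑ x ∈ antidiagonal s, ∑ y ∈ antidiagonal x.2, A.d2 (N x.1) (A.fn (N y.1) (N y.2))
        + ∑ x ∈ antidiagonal s, ∑ y ∈ antidiagonal x.2, A.d2 (N y.1) (A.fn (N x.1) (N y.2))
        + ∑ x ∈ antidiagonal s, ∑ y ∈ antidiagonal x.2, A.d2 (N y.2) (A.fn (N x.1) (N y.1)) := by
      rw [h1, h2]
      module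
    rw [h4]
    simp only [← sum_add_distrib, d2_fn_cyclic, sum_const_zero]
  exact (smul_eq_zero.mp h3).resolve_left three_ne_zero

namespace Deformation

variable {A} {N : A.C1} {n : ℕ} (T : A.Deformation N n)

/-- The coefficients of a deformation of order `n`, continued by the constant sequence `M`. -/
def extend (M : A.C1) (i : ℕ) : A.C1 :=
  if h : i < n + 1 then T.coeff ⟨i, h⟩ else M

theorem extend_val (M : A.C1) (i : Fin (n + 1)) : T.extend M i = T.coeff i :=
  dif_pos i.2

theorem extend_succ (M : A.C1) : T.extend M (n + 1) = M :=
  dif_neg (lt_irrefl _)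

theorem fnCoeff_eq_zero {F : ℕ → A.C1} (hF : ∀ i : Fin (n + 1), F i = T.coeff i) {s : ℕ}
    (hs : s ≤ n) : A.fnCoeff F s = 0 := by
  refine (A.isNijenhuis_seriesMap_iff n F).mp ?_ s hs
  rw [funext hF]
  exact T.isNijenhuis

/-- The coefficient of order `n + 1` of `[N_t, N_t]`, when a term of order `n + 1` is added. -/
theorem fnCoeff_succ {F : ℕ → A.C1} (hF : ∀ i : Fin (n + 1), F i = T.coeff i) :
    A.fnCoeff F (n + 1) = (2 : ℂ) • (A.d1 N (F (n + 1)) - T.obstruction) := by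
  have h0 : F 0 = N := (hF 0).trans T.coeff_zero
  have hob : T.obstruction = (-(1 / 2) : ℂ) •
      ∑ x ∈ (antidiagonal (n + 1)).filter (fun x => 1 ≤ x.1 ∧ 1 ≤ x.2),
        A.fn (F x.1) (F x.2) := by
    rw [obstruction]
    congr 1
    refine Finset.sum_bij' (fun x _ => ((x.1 : ℕ), (x.2 : ℕ)))
      (fun x hx => (⟨x.1, by simp at hx; omega⟩, ⟨x.2, by simp at hx; omega⟩)) ?_ ?_ ?_ ?_ ?_
    · rintro ⟨a, b⟩ h
      simpa [expPairs] using h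
    · rintro ⟨a, b⟩ h
      simpa [expPairs] using h
    · rintro ⟨a, b⟩ h
      rfl
    · rintro ⟨a, b⟩ h
      rfl
    · rintro ⟨a, b⟩ h
      rw [hF, hF]
  -- The pairs excluded from the obstruction are the two ends; each contributes [N, F (n + 1)],
  -- whence the factor 2.
  have hend : (antidiagonal (n + 1)).filter (fun x => ¬(1 ≤ x.1 ∧ 1 ≤ x.2)) =
      {(0, n + 1), (n + 1, 0)} := by
    ext ⟨a, b⟩
    simp
    omega
  rw [fnCoeff, ← sum_filter_add_sum_filter_not _ (fun x : ℕ × ℕ => 1 ≤ x.1 ∧ 1 ≤ x.2), hend,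
    sum_pair (by simp), hob, h0, A.fn_comm (F (n + 1)) N]
  change _ = (2 : ℂ) • (A.fn N (F (n + 1)) - _)
  module

theorem obstruction_mem_Z2 : T.obstruction ∈ A.Z2 N := by
  -- Continuing by zero removes d_N N_{n+1}, so the coefficient of order n + 1 of the square is -2
  -- Ob.
  have h := A.sum_d2_fnCoeff (T.extend 0) (n + 1)
  have hF := T.extend_val 0
  rw [sum_eq_single (0, n + 1)] at h
  · have h0 : T.extend 0 0 = N := (hF 0).trans T.coeff_zero
    rw [T.fnCoeff_succ hF, extend_succ, map_zero, h0, zero_sub, map_smul, map_neg] at h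
    exact neg_eq_zero.mp ((smul_eq_zero.mp h).resolve_left two_ne_zero)
  · rintro ⟨i, j⟩ hij hne
    have hij' : i + j = n + 1 := mem_antidiagonal.mp hij
    have hi : i ≠ 0 := by
      rintro rfl
      exact hne (by rw [← hij', zero_add])
    -- Away from i = 0 the inner coefficient has order j ≤ n and vanishes because the deformation is
    -- Nijenhuis to that order.
    rw [T.fnCoeff_eq_zero hF (show j ≤ n by omega), map_zero]
  · simp

theorem extensible_iff : T.Extensible ↔ T.obstruction ∈ A.B2 N := by
  constructor
  · rintro ⟨T', hT'⟩
    have hF : ∀ i : Fin (n + 1), T'.extend 0 i = T.coeff i := fun i =>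
      (T'.extend_val 0 i.castSucc).trans (hT' i)
    have h := T'.fnCoeff_eq_zero (T'.extend_val 0) le_rfl
    rw [T.fnCoeff_succ hF] at h
    -- The cochain bounding the obstruction is the coefficient of t^{n+1} in the extended
    -- deformation.
    exact ⟨_, sub_eq_zero.mp ((smul_eq_zero.mp h).resolve_left two_ne_zero)⟩
  · rintro ⟨M, hM⟩
    refine ⟨⟨fun i => T.extend M i, (T.extend_val M 0).trans T.coeff_zero, ?_⟩,
      fun i => T.extend_val M i⟩
    rw [isNijenhuis_seriesMap_iff]
    intro s hs
    -- Orders up to n are unaffected by the new term; in order n + 1 the choice d_N M = Ob kills the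
    -- coefficient.
    rcases Nat.le_succ_iff.mp hs with hs' | rfl
    · exact T.fnCoeff_eq_zero (T.extend_val M) hs'
    · rw [T.fnCoeff_succ (T.extend_val M), extend_succ, hM, sub_self, smul_zero]

end Deformation

/-! ### The cohomology class and the theorem -/

theorem H2.mk_eq_zero_iff (N : A.C1) (f : A.C2) (hf : f ∈ A.Z2 N) :
    H2.mk A N f hf = 0 ↔ f ∈ A.B2 N := by
  rw [H2.mk, Submodule.Quotient.mk_eq_zero, Submodule.submoduleOf, Submodule.mem_comap]
  rfl

end LieConformalAlgebra

end LieConformal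

end

theorem mainTheorem7 {L : Type*} [AddCommGroup L] [Module ℂ L]
    (A : LieConformal.LieConformalAlgebra L) (N : A.C1) (hN : A.IsNijenhuis N) :
    (∀ (n : ℕ) (T : A.Deformation N n),
      ∃ hT : T.obstruction ∈ A.Z2 N,
        (T.Extensible ↔
          LieConformal.LieConformalAlgebra.H2.mk A N T.obstruction hT = 0)) ∧
    (Subsingleton (A.H2 N) → ∀ (n : ℕ) (T : A.Deformation N n), T.Extensible) := by
  have key : ∀ (n : ℕ) (T : A.Deformation N n),
      ∃ hT : T.obstruction ∈ A.Z2 N,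
        (T.Extensible ↔
          LieConformal.LieConformalAlgebra.H2.mk A N T.obstruction hT = 0) := fun n T =>
    ⟨T.obstruction_mem_Z2, T.extensible_iff.trans (LieConformal.LieConformalAlgebra.H2.mk_eq_zero_iff A N _ _).symm⟩
  refine ⟨key, fun hH n T => ?_⟩
  obtain ⟨hT, hiff⟩ := key n T
  exact hiff.mpr (Subsingleton.elim _ _)
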